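/- Let $n,d$ be natural numbers, $Y=(0,1)^d$, $\Theta=[-\pi,\pi)^d$, and let $a\in L^\infty(\mathbb R^d;L(\mathbb C^{n\times d}))$ be $\mathbb Z^d$-periodic with $\Re a\ge \nu 1_{\mathbb C^{n\times d}}$ a.e. for some $\nu>0$ (where $\mathbb C^{n\times d}$ carries the inner product $\langle X,Z\rangle=\sum_{i,j}X_{ij}\overline{Z_{ij}}$). Write $a_{ijkl}(y)$ for the entries of $a(y)$, i.e. $(a(y)X)_{ij}=\sum_{k,l}a_{ijkl}(y)X_{kl}$. For $\theta\in\Theta$ let $H^1_\theta(Y)$ be the closure in $H^1(Y)$ of the smooth functions $\phi:\mathbb R^d\to\mathbb C$ with $\phi(\cdot+k)=e^{\mathrm i\theta\cdot k}\phi(\cdot)$ for all $k\in\mathbb Z^d$, let $\nabla u=(\partial_ju_i)_{ij}$, and let $\mathcal H_\theta=[H^1_\theta(Y)\perp e^{\mathrm i\theta\cdot y}]^n$ be the space of those $u\in[H^1_\theta(Y)]^n$ all of whose components are orthogonal to $y\mapsto e^{\mathrm i\theta\cdot y}$ in $L^2(Y)$. Then for every $\theta\in\Theta$, $r\in\{1,\dots,n\}$,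 $s\in\{1,\dots,d\}$ there is a unique $N^{(rs)}_\theta\in\mathcal H_\theta$ with $$\int_Y\big\langle a(y)\big[\nabla N^{(rs)}_\theta(y)+e^{\mathrm i\theta\cdot y}\,e_r\otimes e_s\big],\nabla\phi(y)\big\rangle\,dy=0\qquad\text{for all }\phi\in\mathcal H_\theta .$$ Define the fibre-homogenised tensor $a^{\mathrm{hom}}(\theta)\in L(\mathbb C^{n\times d})$ by $(a^{\mathrm{hom}}(\theta)X)_{ij}=\sum_{r,s}a^{\mathrm{hom}}_{ijrs}(\theta)X_{rs}$ with $$a^{\mathrm{hom}}_{ijrs}(\theta)=\sum_{k=1}^n\sum_{l=1}^d\int_Y a_{ijkl}(y)\big(\partial_lN^{(rs)}_{\theta,k}(y)+e^{\mathrm i\theta\cdot y}\delta_{kr}\delta_{ls}\big)e^{-\mathrm i\theta\cdot y}\,dy .$$ There exists $\kappa>0$ (depending on $n$, $d$, $a$, but not on $\theta$) such that for all $\theta\in\Theta$ $$\|a^{\mathrm{hom}}(\theta)-a^{\mathrm{hom}}(0)\|\le\kappa|\theta|,$$ where $\|\cdot\|$ is the operator norm on $L(\mathbb C^{n\times d})$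 and $|\theta|$ the Euclidean norm. -/

import Mathlib

open MeasureTheory
open scoped ContDiff

namespace FibreHom

noncomputable section

/-- `ℝ^d` with the Euclidean norm. -/
abbrev RR (d : ℕ) : Type := EuclideanSpace ℝ (Fin d)

/-- `ℂ^n` with the Euclidean norm. -/
abbrev CVec (n : ℕ) : Type := EuclideanSpace ℂ (Fin n)

/-- `ℂ^{n×d}` with the Frobenius (Hilbert space) norm; the entry in row `i` and column `j` of `X`
is `X (i, j)`. -/
abbrev CMat (n d : ℕ) : Type := EuclideanSpace ℂ (Fin n × Fin d)

/-- The matrix unit `e_r ⊗ e_s` in `ℂ^{n×d}`. -/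
def unitMat {n d : ℕ} (r : Fin n) (s : Fin d) : CMat n d := EuclideanSpace.single (r, s) 1

/-- The integer vector `k`, as a vector of `ℝ^d`. -/
def intVec {d : ℕ} (k : Fin d → ℤ) : RR d := WithLp.toLp 2 fun j => (k j : ℝ)

/-- The periodicity cell `Y = (0,1)^d`. -/
def cell (d : ℕ) : Set (RR d) := {y | ∀ j, y j ∈ Set.Ioo (0 : ℝ) 1}

/-- The set of quasi-momenta `Θ = [-π,π)^d`. -/
def Theta (d : ℕ) : Set (RR d) := {θ | ∀ j, θ j ∈ Set.Ico (-Real.pi) Real.pi}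

/-- Lebesgue measure on the cell `Y`. -/
def cellMeasure (d : ℕ) : Measure (RR d) := volume.restrict (cell d)

/-- `[L²(Y)]^n`. -/
abbrev L2Vec (n d : ℕ) : Type := Lp (CVec n) 2 (cellMeasure d)

/-- `[L²(Y)]^{n×d}`. -/
abbrev L2Mat (n d : ℕ) : Type := Lp (CMat n d) 2 (cellMeasure d)

/-- The plane wave `e^{i⟨θ,y⟩}`. -/
def planeWave {d : ℕ} (θ y : RR d) : ℂ := Complex.exp (Complex.I * ((inner ℝ θ y : ℝ) : ℂ))

/-- The class of coefficients `a ∈ L^∞(ℝ^d; L(ℂ^{n×d}))` that are `ℤ^d`-periodic and satisfy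
`Re a ≥ ν` for some `ν > 0`. -/
structure IsCoeff {n d : ℕ} (a : RR d → (CMat n d →L[ℂ] CMat n d)) : Prop where
  memLp_top : MemLp a ⊤ volume
  periodic : ∀ k : Fin d → ℤ, ∀ᵐ y ∂volume, a (y + intVec k) = a y
  coercive : ∃ ν : ℝ, 0 < ν ∧
    ∀ᵐ y ∂volume, ∀ X : CMat n d, ν * ‖X‖ ^ 2 ≤ (inner ℂ X (a y X)).re

/-- `φ ∈ [C^∞_θ(Y)]^n`: `φ` is smooth on `ℝ^d` and `φ(· + k) = e^{i⟨θ,k⟩} φ` for `k ∈ ℤ^d`. -/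
structure IsSmoothQuasiPeriodic {n d : ℕ} (θ : RR d) (φ : RR d → CVec n) : Prop where
  contDiff : ContDiff ℝ ∞ φ
  quasiPeriodic : ∀ (k : Fin d → ℤ) (y : RR d), φ (y + intVec k) = planeWave θ (intVec k) • φ y

/-- The classical gradient `(∂_j φ_i)_{i,j}` at `y`. -/
def classicalGrad {n d : ℕ} (φ : RR d → CVec n) (y : RR d) : CMat n d :=
  WithLp.toLp 2 fun ij => fderiv ℝ φ y (EuclideanSpace.single ij.2 1) ij.1

/-- The graph of `grad_θ` on `[C^∞_θ(Y)]^n`. -/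
def smoothGraph (n : ℕ) {d : ℕ} (θ : RR d) : Set (L2Vec n d × L2Mat n d) :=
  {w | ∃ φ : RR d → CVec n, IsSmoothQuasiPeriodic θ φ ∧
    w.1 =ᵐ[cellMeasure d] φ ∧ w.2 =ᵐ[cellMeasure d] classicalGrad φ}

/-- `[H^1_θ(Y)]^n`, a function `u` being recorded together with its gradient, as the pair
`(u, grad_θ u)`. Under `u ↦ (u, grad u)` the `H^1(Y)`-norm is the graph norm, so that the closure
of `[C^∞_θ(Y)]^n` in `[H^1(Y)]^n` becomes the closure of the graph of the classical gradient in
`[L²(Y)]^n × [L²(Y)]^{n×d}` (a limit of gradients is the weak gradient of the limit). -/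
def H1 (n : ℕ) {d : ℕ} (θ : RR d) : Set (L2Vec n d × L2Mat n d) := closure (smoothGraph n θ)

/-- `[H^1_θ(Y) ⊥ e^{i⟨θ,·⟩}]^n`: the `u` in `[H^1_θ(Y)]^n` each of whose components is
`L²(Y)`-orthogonal to the plane wave (again recorded as pairs `(u, grad_θ u)`). -/
def H1perp (n : ℕ) {d : ℕ} (θ : RR d) : Set (L2Vec n d × L2Mat n d) :=
  {w | w ∈ H1 n θ ∧
    ∀ i : Fin n, ∫ y, w.1 y i * (starRingEnd ℂ) (planeWave θ y) ∂(cellMeasure d) = 0}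

/-- `N = (N_θ^{(rs)}, grad_θ N_θ^{(rs)})` solves the cell problem
`⟨a [grad_θ N + e^{i⟨θ,·⟩} e_r ⊗ e_s], grad_θ φ⟩ = 0` for all `φ ∈ [H^1_θ(Y) ⊥ e^{i⟨θ,·⟩}]^n`.
(Mathlib's `inner ℂ x y` is linear in `y`.) -/
def IsCellSolution {n d : ℕ} (a : RR d → (CMat n d →L[ℂ] CMat n d)) (θ : RR d)
    (r : Fin n) (s : Fin d) (N : L2Vec n d × L2Mat n d) : Prop :=
  N ∈ H1perp n θ ∧ ∀ φ ∈ H1perp n θ,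
    ∫ y, inner ℂ (φ.2 y) (a y (N.2 y + planeWave θ y • unitMat r s)) ∂(cellMeasure d) = 0

/-- The solution `(N_θ^{(rs)}, grad_θ N_θ^{(rs)})` of the cell problem. -/
def cellSolution {n d : ℕ} (a : RR d → (CMat n d →L[ℂ] CMat n d)) (θ : RR d)
    (r : Fin n) (s : Fin d) : L2Vec n d × L2Mat n d :=
  Classical.epsilon (IsCellSolution a θ r s)

/-- The entries of the tensor `a(y)`: `(a(y) X)_{ij} = ∑_{k,l} a_{ijkl}(y) X_{kl}`. -/
def coeffEntry {n d : ℕ} (a : RR d → (CMat n d →L[ℂ] CMat n d)) (i : Fin n) (j : Fin d)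
    (k : Fin n) (l : Fin d) (y : RR d) : ℂ :=
  a y (unitMat k l) (i, j)

/-- The entries of the fibre-homogenised tensor,
`a^hom_{ijrs}(θ) = ∑_{k,l} ∫_Y a_{ijkl} (∂_l N_{θ,k}^{(rs)} + e^{iθ·y} δ_{kr} δ_{ls}) e^{-iθ·y} dy`;
rows are indexed by `(i, j)` and columns by `(r, s)`. -/
def ahomMatrix {n d : ℕ} (a : RR d → (CMat n d →L[ℂ] CMat n d)) (θ : RR d) :
    Matrix (Fin n × Fin d) (Fin n × Fin d) ℂ :=
  fun ij rs => ∑ k : Fin n, ∑ l : Fin d,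
    ∫ y, coeffEntry a ij.1 ij.2 k l y *
      ((cellSolution a θ rs.1 rs.2).2 y (k, l) +
        planeWave θ y * (if k = rs.1 then 1 else 0) * (if l = rs.2 then 1 else 0)) *
      planeWave (-θ) y ∂(cellMeasure d)

/-- The fibre-homogenised tensor `a^hom(θ)` as an operator on the Hilbert space `ℂ^{n×d}`. -/
def ahom {n d : ℕ} (a : RR d → (CMat n d →L[ℂ] CMat n d)) (θ : RR d) :
    CMat n d →L[ℂ] CMat n d :=
  Matrix.toEuclideanCLM (𝕜 := ℂ) (n := Fin n × Fin d) (ahomMatrix a θ)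

end

end FibreHom

/-!
Multiplication by `e^{i⟨θ,·⟩}` maps the periodic functions of zero mean, a space independent of `θ`,
onto the functions in `H^1_θ(Y)` orthogonal to `e^{i⟨θ,·⟩}`, and turns `grad_θ` into
`grad + i(·) ⊗ θ`. The cell problems for all `θ` thereby live on one space, with one coefficient and
one right-hand side. On the Fourier mode `k` the operator `grad + i(·) ⊗ θ` acts as
`i(·) ⊗ (θ + 2πk)`, and `|θ + 2πk| ≥ π` for `k ≠ 0` as long as every `|θ_j| ≤ π`; by Parseval,
`π ‖u‖ ≤ ‖grad u + i u ⊗ θ‖` for `u` of zero mean, uniformly in `θ`. Hence the gradients for `θ` and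
`η` differ by at most `|θ - η| / π` relative to either of them. With coercivity of `a` this gives
unique solvability by Lax-Milgram and, by an energy estimate, Lipschitz dependence of the fluxes on
`θ`, whose means are the columns of `a^hom(θ)`.
-/

namespace FibreHom

noncomputable section

section Cell

variable {d : ℕ}

lemma measurableSet_cell (d : ℕ) : MeasurableSet (cell d) := by
  simp only [cell, Set.ofPred_forall]
  exact MeasurableSet.iInter fun j => measurableSet_Ioo.preimage (by fun_prop)

lemma ae_mem_cell (d : ℕ) : ∀ᵐ y ∂(cellMeasure d), y ∈ cell d :=
  ae_restrict_mem (measurableSet_cell d)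

lemma isBounded_cell (d : ℕ) : Bornology.IsBounded (cell d) := by
  have h : Bornology.IsBounded (Set.univ.pi fun _ : Fin d => Set.Ioo (0 : ℝ) 1) :=
    Bornology.IsBounded.pi fun _ => Metric.isBounded_Ioo 0 1
  refine ((PiLp.antilipschitzWith_ofLp 2 _).isBounded_preimage h).subset fun y hy j _ => hy j

lemma measurePreserving_ofLp_cell (d : ℕ) :
    MeasurePreserving (WithLp.ofLp : RR d → Fin d → ℝ) (cellMeasure d)
      (Measure.pi fun _ => volume.restrict (Set.Ioo (0 : ℝ) 1)) := by
  rw [← Measure.restrict_pi_pi, ← volume_pi]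
  have hcell : cell d = WithLp.ofLp ⁻¹' (Set.univ.pi fun _ => Set.Ioo (0 : ℝ) 1) := by
    ext y
    simp [cell]
  rw [cellMeasure, hcell]
  exact (PiLp.volume_preserving_ofLp (Fin d)).restrict_preimage
    (MeasurableSet.univ_pi fun _ => measurableSet_Ioo)

/-- The normalised Haar measure on the torus `(ℝ/ℤ)^d`, to which integrals over the cell are
transported in order to use translation invariance and Parseval's identity. (The canonical measure
of `UnitAddCircle` is not the Haar measure definitionally, only provably.) -/
def torusMeasure (d : ℕ) : Measure (UnitAddTorus (Fin d)) :=
  Measure.pi fun _ => AddCircle.haarAddCircle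

instance (d : ℕ) : (torusMeasure d).IsAddHaarMeasure := by
  unfold torusMeasure; infer_instance

instance (d : ℕ) : IsProbabilityMeasure (torusMeasure d) := by
  unfold torusMeasure; infer_instance

/-- The projection of `ℝ^d` onto the torus. -/
def toTorus (y : RR d) : UnitAddTorus (Fin d) := fun j => (y j : UnitAddCircle)

/-- The representative in `(0,1]^d` of a point of the torus. -/
def fromTorus (x : UnitAddTorus (Fin d)) : RR d :=
  WithLp.toLp 2 fun j => (AddCircle.equivIoc (1 : ℝ) 0 (x j) : ℝ)

lemma toTorus_add (y z : RR d) : toTorus (y + z) = toTorus y + toTorus z := by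
  funext j; simp [toTorus]

@[simp] lemma toTorus_fromTorus (x : UnitAddTorus (Fin d)) : toTorus (fromTorus x) = x := by
  funext j
  exact (AddCircle.equivIoc (1 : ℝ) 0).symm_apply_apply (x j)

lemma fromTorus_toTorus {y : RR d} (hy : y ∈ cell d) : fromTorus (toTorus y) = y := by
  ext j
  have h : y j ∈ Set.Ioc (0 : ℝ) (0 + 1) := ⟨(hy j).1, by linarith [(hy j).2]⟩
  exact congrArg Subtype.val ((AddCircle.equivIoc (1 : ℝ) 0).apply_symm_apply ⟨y j, h⟩)

lemma exists_fromTorus_toTorus (y : RR d) :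
    ∃ k : Fin d → ℤ, fromTorus (toTorus y) = y + intVec k := by
  have h (j : Fin d) : ∃ m : ℤ, fromTorus (toTorus y) j = y j + m := by
    have h0 : ((fromTorus (toTorus y) j - y j : ℝ) : UnitAddCircle) = 0 := by
      rw [AddCircle.coe_sub, sub_eq_zero]
      exact congrFun (toTorus_fromTorus (toTorus y)) j
    obtain ⟨m, hm⟩ := (AddCircle.coe_eq_zero_iff (1 : ℝ)).1 h0
    simp only [zsmul_eq_mul, mul_one] at hm
    exact ⟨m, by linarith⟩
  choose k hk using h
  exact ⟨k, by ext j; simpa [intVec] using hk j⟩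

lemma measurable_toTorus : Measurable (toTorus (d := d)) :=
  measurable_pi_lambda _ fun _ => AddCircle.measurable_mk'.comp (by fun_prop)

lemma measurable_fromTorus : Measurable (fromTorus (d := d)) :=
  (WithLp.measurable_toLp 2 _).comp <| measurable_pi_lambda _ fun j =>
    measurable_subtype_coe.comp
      ((AddCircle.measurableEquivIoc (1 : ℝ) 0).measurable.comp (measurable_pi_apply j))

lemma measurePreserving_toTorus (d : ℕ) :
    MeasurePreserving toTorus (cellMeasure d) (torusMeasure d) := by
  refine MeasurePreserving.comp (g := fun (x : Fin d → ℝ) j => (x j : UnitAddCircle))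
    (measurePreserving_pi _ _ fun _ => ?_) (measurePreserving_ofLp_cell d)
  have h := AddCircle.measurePreserving_mk 1 0
  rwa [AddCircle.volume_eq_smul_haarAddCircle, ENNReal.ofReal_one, one_smul, zero_add,
    ← Measure.restrict_congr_set Ioo_ae_eq_Ioc] at h

instance (d : ℕ) : IsProbabilityMeasure (cellMeasure d) where
  measure_univ := by
    simpa using (measurePreserving_toTorus d).measure_preimage MeasurableSet.univ.nullMeasurableSet

lemma measurePreserving_fromTorus (d : ℕ) :
    MeasurePreserving fromTorus (torusMeasure d) (cellMeasure d) := by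
  refine ⟨measurable_fromTorus, ?_⟩
  rw [← (measurePreserving_toTorus d).map_eq,
    Measure.map_map measurable_fromTorus measurable_toTorus]
  refine (Measure.map_congr ?_).trans Measure.map_id
  filter_upwards [ae_mem_cell d] with y hy using fromTorus_toTorus hy

variable {E : Type*} [NormedAddCommGroup E]

lemma integrable_cell_of_continuous {g : RR d → E} (hg : Continuous g) :
    Integrable g (cellMeasure d) := by
  obtain ⟨C, hC⟩ := (isBounded_cell d).isCompact_closure.exists_bound_of_continuousOn
    hg.continuousOn
  refine Integrable.of_bound hg.aestronglyMeasurable C ?_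
  filter_upwards [ae_mem_cell d] with y hy using hC y (subset_closure hy)

variable [NormedSpace ℝ E]

lemma integral_comp_fromTorus {f : RR d → E} (hf : AEStronglyMeasurable f (cellMeasure d)) :
    ∫ x, f (fromTorus x) ∂(torusMeasure d) = ∫ y, f y ∂(cellMeasure d) := by
  rw [← (measurePreserving_fromTorus d).map_eq] at hf ⊢
  exact (integral_map measurable_fromTorus.aemeasurable hf).symm

lemma integral_cell_comp_add_right {g : RR d → E} (hg : Continuous g)
    (hper : ∀ (k : Fin d → ℤ) y, g (y + intVec k) = g y) (z : RR d) :
    ∫ y, g (y + z) ∂(cellMeasure d) = ∫ y, g y ∂(cellMeasure d) := by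
  have hG (y : RR d) : g (fromTorus (toTorus y)) = g y := by
    obtain ⟨k, hk⟩ := exists_fromTorus_toTorus y
    rw [hk, hper]
  have hz : Continuous fun y => g (y + z) := hg.comp (continuous_add_const z)
  calc ∫ y, g (y + z) ∂(cellMeasure d)
      = ∫ x, g (fromTorus (x + toTorus z)) ∂(torusMeasure d) := by
        rw [← integral_comp_fromTorus hz.aestronglyMeasurable]
        congr! 2 with x
        rw [← hG (fromTorus x + z), toTorus_add, toTorus_fromTorus]
    _ = ∫ x, g (fromTorus x) ∂(torusMeasure d) :=
        integral_add_right_eq_self (fun x => g (fromTorus x)) (toTorus z)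
    _ = ∫ y, g y ∂(cellMeasure d) := integral_comp_fromTorus hg.aestronglyMeasurable

lemma hasDerivAt_integral_cell_comp_add_smul {g : RR d → E} (hg : ContDiff ℝ 1 g) (z : RR d) :
    HasDerivAt (fun t : ℝ => ∫ y, g (y + t • z) ∂(cellMeasure d))
      (∫ y, fderiv ℝ g y z ∂(cellMeasure d)) 0 := by
  have hc : Continuous fun y => fderiv ℝ g y z :=
    (hg.continuous_fderiv one_ne_zero).clm_apply continuous_const
  obtain ⟨R, hR⟩ := (Metric.isBounded_iff_subset_closedBall 0).1 (isBounded_cell d)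
  obtain ⟨C, hC⟩ := (isCompact_closedBall (0 : RR d) (R + ‖z‖)).exists_bound_of_continuousOn
    hc.continuousOn
  have hbound : ∀ᵐ y ∂(cellMeasure d), ∀ t ∈ Metric.ball (0 : ℝ) 1,
      ‖fderiv ℝ g (y + t • z) z‖ ≤ C := by
    filter_upwards [ae_mem_cell d] with y hy t ht
    refine hC _ (mem_closedBall_zero_iff.2 ?_)
    rw [mem_ball_zero_iff] at ht
    calc ‖y + t • z‖ ≤ ‖y‖ + ‖t‖ * ‖z‖ := by rw [← norm_smul]; exact norm_add_le _ _
      _ ≤ R + ‖z‖ := add_le_add (mem_closedBall_zero_iff.1 (hR hy))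
          (mul_le_of_le_one_left (norm_nonneg z) ht.le)
  have hderiv (y : RR d) (t : ℝ) :
      HasDerivAt (fun t : ℝ => g (y + t • z)) (fderiv ℝ g (y + t • z) z) t := by
    have hline : HasDerivAt (fun t : ℝ => y + t • z) z t := by
      simpa using ((hasDerivAt_id t).smul_const z).const_add y
    exact (hg.differentiable one_ne_zero _).hasFDerivAt.comp_hasDerivAt t hline
  simpa using (hasDerivAt_integral_of_dominated_loc_of_deriv_le (𝕜 := ℝ)
    (F := fun t y => g (y + t • z)) (x₀ := 0) (Metric.ball_mem_nhds 0 one_pos)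
    (.of_forall fun t => (hg.continuous.comp (continuous_add_const _)).aestronglyMeasurable)
    (by simpa using integrable_cell_of_continuous hg.continuous)
    (by simpa using hc.aestronglyMeasurable) hbound (integrable_const C)
    (.of_forall fun y t _ => hderiv y t)).2

lemma integral_cell_fderiv_eq_zero {g : RR d → E} (hg : ContDiff ℝ 1 g)
    (hper : ∀ (k : Fin d → ℤ) y, g (y + intVec k) = g y) (z : RR d) :
    ∫ y, fderiv ℝ g y z ∂(cellMeasure d) = 0 := by
  have h := hasDerivAt_integral_cell_comp_add_smul hg z
  simp only [integral_cell_comp_add_right hg.continuous hper] at h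
  exact h.unique (hasDerivAt_const _ _)

end Cell

section VariationalProblem

variable {𝕜 V H : Type*} [RCLike 𝕜] [NormedAddCommGroup V] [NormedSpace 𝕜 V]
  [NormedAddCommGroup H] [InnerProductSpace 𝕜 H]

lemma existsUnique_forall_inner_map_eq (S : Submodule 𝕜 H) [CompleteSpace S] {A : H →L[𝕜] H}
    {ν : ℝ} (hν : 0 < ν) (hA : ∀ x, ν * ‖x‖ ^ 2 ≤ RCLike.re (inner 𝕜 x (A x))) (f : H) :
    ∃! x : S, ∀ y : S, inner 𝕜 (y : H) (A x) = inner 𝕜 (y : H) f := by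
  let T : S →L[𝕜] S := S.orthogonalProjectionOnto ∘L A ∘L S.subtypeL
  have hT (x y : S) : inner 𝕜 y (T x) = inner 𝕜 (y : H) (A x) :=
    S.inner_orthogonalProjectionOnto_eq_of_mem_left y (A x)
  have hcoercive (x : S) : ‖x‖ ^ 2 * (⟨ν, hν.le⟩ : NNReal) ≤ ‖inner 𝕜 (T x) x‖ := by
    rw [norm_inner_symm, hT, mul_comm]
    exact (hA x).trans (RCLike.re_le_norm _)
  have hbij : Function.Bijective T := ContinuousLinearMap.isUnit_iff_bijective.1
    (T.isUnit_of_forall_le_norm_inner_map hν hcoercive)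
  refine (existsUnique_congr fun x => ?_).1 (hbij.existsUnique (S.orthogonalProjectionOnto f))
  rw [ext_iff_inner_left 𝕜]
  simp only [hT, S.inner_orthogonalProjectionOnto_eq_of_mem_left]

theorem existsUnique_forall_inner_map_add_eq_zero [CompleteSpace V] {D : V →L[𝕜] H}
    {A : H →L[𝕜] H} {ν : ℝ} {c : NNReal} (hD : AntilipschitzWith c D) (hν : 0 < ν)
    (hA : ∀ x, ν * ‖x‖ ^ 2 ≤ RCLike.re (inner 𝕜 x (A x))) (f : H) :
    ∃! x, ∀ y, inner 𝕜 (D y) (A (D x + f)) = 0 := by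
  have : CompleteSpace (LinearMap.range D.toLinearMap) :=
    (hD.isComplete_range D.uniformContinuous).completeSpace_coe
  obtain ⟨⟨_, x, rfl⟩, hx, huniq⟩ :=
    existsUnique_forall_inner_map_eq (LinearMap.range D.toLinearMap) hν hA (-A f)
  have hiff (z : V) : (∀ y, inner 𝕜 (D y) (A (D z + f)) = 0) ↔
      ∀ y : LinearMap.range D.toLinearMap, inner 𝕜 (y : H) (A (D z)) = inner 𝕜 (y : H) (-A f) := by
    simp only [map_add, inner_add_right, add_eq_zero_iff_eq_neg, inner_neg_right, Subtype.forall,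
      LinearMap.mem_range, ContinuousLinearMap.coe_coe, forall_exists_index,
      forall_apply_eq_imp_iff]
  refine ⟨x, (hiff x).2 hx, fun z hz => hD.injective ?_⟩
  exact congrArg Subtype.val (huniq ⟨D z, z, rfl⟩ ((hiff z).1 hz))

lemma mul_norm_le_of_norm_inner_map_le {A : H →L[𝕜] H} {ν M : ℝ} {p : H} (hM : 0 ≤ M)
    (hA : ν * ‖p‖ ^ 2 ≤ RCLike.re (inner 𝕜 p (A p))) (h : ‖inner 𝕜 p (A p)‖ ≤ ‖p‖ * M) :
    ν * ‖p‖ ≤ M := by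
  rcases (norm_nonneg p).eq_or_lt with hp | hp
  · rwa [← hp, mul_zero]
  · refine le_of_mul_le_mul_left ?_ hp
    calc ‖p‖ * (ν * ‖p‖) = ν * ‖p‖ ^ 2 := by ring
      _ ≤ ‖p‖ * M := (hA.trans (RCLike.re_le_norm _)).trans h

lemma norm_inner_map_le (A : H →L[𝕜] H) (x y : H) : ‖inner 𝕜 x (A y)‖ ≤ ‖x‖ * (‖A‖ * ‖y‖) :=
  (norm_inner_le_norm _ _).trans (mul_le_mul_of_nonneg_left (A.le_opNorm y) (norm_nonneg x))

lemma norm_le_of_inner_map_add_eq_zero {A : H →L[𝕜] H} {ν : ℝ} (hν : 0 < ν)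
    (hA : ∀ x, ν * ‖x‖ ^ 2 ≤ RCLike.re (inner 𝕜 x (A x))) {p f : H}
    (h : inner 𝕜 p (A (p + f)) = 0) : ‖p‖ ≤ ‖A‖ / ν * ‖f‖ := by
  rw [map_add, inner_add_right, add_eq_zero_iff_eq_neg] at h
  rw [div_mul_eq_mul_div, le_div_iff₀' hν]
  refine mul_norm_le_of_norm_inner_map_le (by positivity) (hA p) ?_
  rw [h, norm_neg]
  exact norm_inner_map_le A p f

/-- Testing both problems with `e = x - x'` gives
`⟪D e, A (D e)⟫ = -⟪D e, A ((D - D') x')⟫ - ⟪(D - D') e, A (D' x' + f)⟫`. -/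
lemma norm_map_sub_le_of_inner_map_add_eq_zero {D D' : V →L[𝕜] H} {A : H →L[𝕜] H} {ν δ : ℝ}
    (hν : 0 < ν) (hA : ∀ x, ν * ‖x‖ ^ 2 ≤ RCLike.re (inner 𝕜 x (A x))) (hδ : 0 ≤ δ)
    (hD : ∀ v, ‖D v - D' v‖ ≤ δ * ‖D v‖) {f : H} {x x' : V}
    (hx : ∀ y, inner 𝕜 (D y) (A (D x + f)) = 0) (hx' : ∀ y, inner 𝕜 (D' y) (A (D' x' + f)) = 0) :
    ‖D (x - x')‖ ≤ ‖A‖ / ν * (‖D x' - D' x'‖ + δ * ‖D' x' + f‖) := by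
  set e := x - x'
  have hsplit : D x + f = D e + (D x' - D' x') + (D' x' + f) := by
    rw [map_sub D x x']; abel
  have henergy : inner 𝕜 (D e) (A (D e)) =
      -inner 𝕜 (D e) (A (D x' - D' x')) - inner 𝕜 (D e - D' e) (A (D' x' + f)) := by
    have h := hx e
    rw [hsplit, map_add, map_add, inner_add_right, inner_add_right] at h
    rw [inner_sub_left, hx' e]
    linear_combination h
  rw [div_mul_eq_mul_div, le_div_iff₀' hν]
  refine mul_norm_le_of_norm_inner_map_le (by positivity) (hA _) ?_
  calc ‖inner 𝕜 (D e) (A (D e))‖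
      ≤ ‖inner 𝕜 (D e) (A (D x' - D' x'))‖ + ‖inner 𝕜 (D e - D' e) (A (D' x' + f))‖ := by
        rw [henergy, ← norm_neg (inner 𝕜 (D e) (A (D x' - D' x')))]
        exact norm_sub_le _ _
    _ ≤ ‖D e‖ * (‖A‖ * ‖D x' - D' x'‖) + δ * ‖D e‖ * (‖A‖ * ‖D' x' + f‖) := by
        gcongr
        · exact norm_inner_map_le A _ _
        · exact (norm_inner_map_le A _ _).trans (mul_le_mul_of_nonneg_right (hD e) (by positivity))
    _ = ‖D e‖ * (‖A‖ * (‖D x' - D' x'‖ + δ * ‖D' x' + f‖)) := by ring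

theorem norm_map_add_sub_map_add_le {D D' : V →L[𝕜] H} {A : H →L[𝕜] H} {ν δ : ℝ}
    (hν : 0 < ν) (hA : ∀ x, ν * ‖x‖ ^ 2 ≤ RCLike.re (inner 𝕜 x (A x))) (hδ : 0 ≤ δ)
    (hD : ∀ v, ‖D v - D' v‖ ≤ δ * ‖D v‖) (hD' : ∀ v, ‖D v - D' v‖ ≤ δ * ‖D' v‖) {f : H} {x x' : V}
    (hx : ∀ y, inner 𝕜 (D y) (A (D x + f)) = 0) (hx' : ∀ y, inner 𝕜 (D' y) (A (D' x' + f)) = 0) :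
    ‖(D x + f) - (D' x' + f)‖ ≤ 2 * (‖A‖ / ν) * (1 + ‖A‖ / ν) * δ * ‖f‖ := by
  set K := ‖A‖ / ν
  have hgrad : ‖D' x'‖ ≤ K * ‖f‖ := norm_le_of_inner_map_add_eq_zero hν hA (hx' x')
  have hfield : ‖D' x' + f‖ ≤ (1 + K) * ‖f‖ :=
    (norm_add_le _ _).trans (by rw [add_mul, one_mul, add_comm]; gcongr)
  have hpert : ‖D x' - D' x'‖ ≤ δ * (K * ‖f‖) := (hD' x').trans (by gcongr)
  have hsplit : (D x + f) - (D' x' + f) = D (x - x') + (D x' - D' x') := by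
    rw [map_sub]; abel
  calc ‖(D x + f) - (D' x' + f)‖
      ≤ K * (‖D x' - D' x'‖ + δ * ‖D' x' + f‖) + ‖D x' - D' x'‖ := by
        rw [hsplit]
        exact (norm_add_le _ _).trans (by
          gcongr; exact norm_map_sub_le_of_inner_map_add_eq_zero hν hA hδ hD hx hx')
    _ ≤ K * (δ * (K * ‖f‖) + δ * ((1 + K) * ‖f‖)) + δ * (K * ‖f‖) := by gcongr
    _ = 2 * K * (1 + K) * δ * ‖f‖ := by ring

end VariationalProblem

section LpOperators

variable {𝕜 α E F : Type*} [RCLike 𝕜] [MeasurableSpace α] {μ : Measure α}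

/-- Multiplication by an essentially bounded operator field, as an operator on `L²`. -/
def mulOp [NormedAddCommGroup E] [NormedSpace 𝕜 E] [NormedAddCommGroup F] [NormedSpace 𝕜 F]
    (A : α → E →L[𝕜] F) (hA : MemLp A ⊤ μ) : Lp E 2 μ →L[𝕜] Lp F 2 μ :=
  (ContinuousLinearMap.id 𝕜 (E →L[𝕜] F)).holderL μ ⊤ 2 2 (hA.toLp A)

lemma coeFn_mulOp [NormedAddCommGroup E] [NormedSpace 𝕜 E] [NormedAddCommGroup F]
    [NormedSpace 𝕜 F] {A : α → E →L[𝕜] F} (hA : MemLp A ⊤ μ) (u : Lp E 2 μ) :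
    mulOp A hA u =ᵐ[μ] fun y => A y (u y) := by
  filter_upwards [(ContinuousLinearMap.id 𝕜 (E →L[𝕜] F)).coeFn_holder (r := 2) (hA.toLp A) u,
    hA.coeFn_toLp] with y hy hAy
  exact hy.trans (congrArg (· (u y)) hAy)

lemma norm_sq_eq_integral_norm_sq [NormedAddCommGroup E] (u : Lp E 2 μ) :
    ‖u‖ ^ 2 = ∫ y, ‖u y‖ ^ 2 ∂μ := by
  have hnonneg : 0 ≤ ∫ y, ‖u y‖ ^ 2 ∂μ := integral_nonneg fun y => sq_nonneg _
  rw [Lp.norm_def, (Lp.memLp u).eLpNorm_eq_integral_rpow_norm two_ne_zero ENNReal.ofNat_ne_top]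
  simp only [ENNReal.toReal_ofNat, Real.rpow_ofNat]
  rw [ENNReal.toReal_ofReal (by positivity), ← one_div, ← Real.sqrt_eq_rpow, Real.sq_sqrt hnonneg]

lemma mul_norm_sq_le_re_inner_mulOp [NormedAddCommGroup E] [InnerProductSpace 𝕜 E]
    {A : α → E →L[𝕜] E} (hA : MemLp A ⊤ μ) {ν : ℝ}
    (h : ∀ᵐ y ∂μ, ∀ x, ν * ‖x‖ ^ 2 ≤ RCLike.re (inner 𝕜 x (A y x))) (u : Lp E 2 μ) :
    ν * ‖u‖ ^ 2 ≤ RCLike.re (inner 𝕜 u (mulOp A hA u)) := by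
  have hint : Integrable (fun y => inner 𝕜 (u y) (mulOp A hA u y)) μ := L2.integrable_inner u _
  rw [norm_sq_eq_integral_norm_sq, ← integral_const_mul, L2.inner_def, ← integral_re hint]
  refine integral_mono_ae (((Lp.memLp u).integrable_norm_pow two_ne_zero).const_mul ν) hint.re ?_
  filter_upwards [h, coeFn_mulOp hA u] with y hy hAu
  rw [hAu]
  exact hy (u y)

variable [NormedAddCommGroup E] [IsProbabilityMeasure μ]

lemma norm_const_eq (x : E) : ‖Lp.const 2 μ x‖ = ‖x‖ := by
  rw [Lp.norm_const _ _ _ two_ne_zero, probReal_univ, Real.one_rpow, mul_one]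

variable [InnerProductSpace ℂ E] [CompleteSpace E]

/-- The mean value `∫ u dμ` of an `L²` function with respect to a probability measure, as a
continuous linear map: the adjoint of the embedding of the constants. -/
def mean : Lp E 2 μ →L[ℂ] E := (Lp.constL 2 μ ℂ).adjoint

lemma mean_eq_integral (u : Lp E 2 μ) : mean u = ∫ y, u y ∂μ := by
  refine ext_inner_left ℂ fun x => ?_
  rw [mean, ContinuousLinearMap.adjoint_inner_right,
    ← integral_inner ((Lp.memLp u).integrable one_le_two), L2.inner_def]
  refine integral_congr_ae ?_
  filter_upwards [Lp.coeFn_const 2 μ x] with y hy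
  exact congrArg (inner ℂ · (u y)) hy

lemma norm_mean_le (u : Lp E 2 μ) : ‖mean u‖ ≤ ‖u‖ := by
  refine (mean.le_opNorm u).trans (mul_le_of_le_one_left (norm_nonneg u) ?_)
  rw [mean, LinearIsometryEquiv.norm_map]
  exact (Lp.norm_constL_le 2 μ ℂ).trans_eq (by simp)

lemma mean_compLpL [NormedAddCommGroup F] [InnerProductSpace ℂ F] [CompleteSpace F] (L : E →L[ℂ] F)
    (u : Lp E 2 μ) : mean (L.compLpL 2 μ u) = L (mean u) := by
  rw [mean_eq_integral, mean_eq_integral, integral_congr_ae (L.coeFn_compLpL u),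
    L.integral_comp_comm ((Lp.memLp u).integrable one_le_two)]

end LpOperators

section PlaneWave

variable {d : ℕ}

lemma planeWave_zero_left (y : RR d) : planeWave 0 y = 1 := by simp [planeWave]

lemma planeWave_add_left (θ η y : RR d) :
    planeWave (θ + η) y = planeWave θ y * planeWave η y := by
  simp [planeWave, inner_add_left, mul_add, Complex.exp_add]

lemma planeWave_add_right (θ y z : RR d) :
    planeWave θ (y + z) = planeWave θ y * planeWave θ z := by
  simp [planeWave, inner_add_right, mul_add, Complex.exp_add]

lemma conj_planeWave (θ y : RR d) : (starRingEnd ℂ) (planeWave θ y) = planeWave (-θ) y := by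
  simp [planeWave, ← Complex.exp_conj]

lemma norm_planeWave (θ y : RR d) : ‖planeWave θ y‖ = 1 := by
  rw [planeWave, mul_comm]
  exact Complex.norm_exp_ofReal_mul_I _

lemma hasFDerivAt_planeWave (θ y : RR d) :
    HasFDerivAt (planeWave θ)
      (planeWave θ y • (Complex.I • (Complex.ofRealCLM.comp (innerSL ℝ θ)))) y :=
  ((Complex.ofRealCLM.comp (innerSL ℝ θ)).hasFDerivAt.const_mul Complex.I).cexp

lemma contDiff_planeWave (θ : RR d) {m : WithTop ℕ∞} : ContDiff ℝ m (planeWave θ) :=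
  (contDiff_const.mul (Complex.ofRealCLM.comp (innerSL ℝ θ)).contDiff).cexp

lemma continuous_planeWave (θ : RR d) : Continuous (planeWave θ) :=
  (contDiff_planeWave (m := 0) θ).continuous

/-- The vector `2πk` of the lattice dual to `ℤ^d`: the plane waves `e^{i⟨2πk,y⟩}` are the periodic
ones. -/
def freq (k : Fin d → ℤ) : RR d := (2 * Real.pi) • intVec k

lemma freq_apply (k : Fin d → ℤ) (j : Fin d) : freq k j = 2 * Real.pi * k j := rfl

lemma freq_zero : freq (0 : Fin d → ℤ) = 0 := by
  ext j
  simp [freq_apply]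

lemma planeWave_freq_intVec (k m : Fin d → ℤ) : planeWave (freq k) (intVec m) = 1 := by
  have hinner : inner ℝ (freq k) (intVec m) = ((∑ j, k j * m j : ℤ) : ℝ) * (2 * Real.pi) := by
    rw [freq, real_inner_smul_left, mul_comm]
    simp [intVec, PiLp.inner_apply, mul_comm]
  rw [planeWave, hinner, Complex.exp_eq_one_iff]
  exact ⟨∑ j, k j * m j, by push_cast; ring⟩

lemma mFourier_toTorus (k : Fin d → ℤ) (y : RR d) :
    UnitAddTorus.mFourier k (toTorus y) = planeWave (freq k) y := by
  simp only [UnitAddTorus.mFourier, ContinuousMap.coe_mk, toTorus, fourier_coe_apply, planeWave,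
    ← Complex.exp_sum, PiLp.inner_apply, freq_apply]
  congr 1
  push_cast
  rw [Finset.mul_sum]
  refine Finset.sum_congr rfl fun j _ => ?_
  simp
  ring

end PlaneWave

section Modulation

variable {d : ℕ} {E : Type*} [NormedAddCommGroup E] [NormedSpace ℂ E]

lemma memLp_planeWave_smul_id (θ : RR d) :
    MemLp (fun y => planeWave θ y • ContinuousLinearMap.id ℂ E) ⊤ (cellMeasure d) :=
  MemLp.of_bound ((continuous_planeWave θ).smul continuous_const).aestronglyMeasurable
    ‖ContinuousLinearMap.id ℂ E‖ (.of_forall fun y => by rw [norm_smul, norm_planeWave, one_mul])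

/-- Multiplication by the plane wave `e^{i⟨θ,y⟩}`, as a linear isometry of `L²(Y)`. -/
def modulate (θ : RR d) : Lp E 2 (cellMeasure d) →ₗᵢ[ℂ] Lp E 2 (cellMeasure d) where
  toLinearMap := (mulOp _ (memLp_planeWave_smul_id θ)).toLinearMap
  norm_map' u := by
    refine congrArg ENNReal.toReal (eLpNorm_congr_norm_ae ?_)
    filter_upwards [coeFn_mulOp (memLp_planeWave_smul_id θ) u] with y hy
    refine (congrArg norm hy).trans ?_
    rw [smul_apply, norm_smul, norm_planeWave, one_mul,
      ContinuousLinearMap.id_apply]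

lemma coeFn_modulate (θ : RR d) (u : Lp E 2 (cellMeasure d)) :
    modulate θ u =ᵐ[cellMeasure d] fun y => planeWave θ y • u y :=
  coeFn_mulOp (memLp_planeWave_smul_id θ) u

lemma modulate_zero (u : Lp E 2 (cellMeasure d)) : modulate 0 u = u := by
  refine Lp.ext ?_
  filter_upwards [coeFn_modulate 0 u] with y hy
  rw [hy, planeWave_zero_left, one_smul]

lemma modulate_modulate (θ η : RR d) (u : Lp E 2 (cellMeasure d)) :
    modulate θ (modulate η u) = modulate (θ + η) u := by
  refine Lp.ext ?_
  filter_upwards [coeFn_modulate θ (modulate η u), coeFn_modulate η u,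
    coeFn_modulate (θ + η) u] with y hθη hη hsum
  rw [hθη, hη, hsum, smul_smul, planeWave_add_left]

lemma mulOp_modulate {F : Type*} [NormedAddCommGroup F] [NormedSpace ℂ F] {A : RR d → E →L[ℂ] F}
    (hA : MemLp A ⊤ (cellMeasure d)) (θ : RR d) (u : Lp E 2 (cellMeasure d)) :
    mulOp A hA (modulate θ u) = modulate θ (mulOp A hA u) := by
  refine Lp.ext ?_
  filter_upwards [coeFn_mulOp hA (modulate θ u), coeFn_modulate θ u,
    coeFn_modulate θ (mulOp A hA u), coeFn_mulOp hA u] with y hAm hm hmA hAu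
  rw [hAm, hm, hmA, hAu, map_smul]

lemma modulate_compLpL {F : Type*} [NormedAddCommGroup F] [NormedSpace ℂ F] (L : E →L[ℂ] F)
    (θ : RR d) (u : Lp E 2 (cellMeasure d)) :
    modulate θ (L.compLpL 2 _ u) = L.compLpL 2 _ (modulate θ u) := by
  refine Lp.ext ?_
  filter_upwards [coeFn_modulate θ (L.compLpL 2 _ u), L.coeFn_compLpL u,
    L.coeFn_compLpL (modulate θ u), coeFn_modulate θ u] with y hmL hL hLm hm
  rw [hmL, hL, hLm, hm, map_smul]

end Modulation

section Parseval

variable {d : ℕ}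

lemma hasSum_sq_norm_integral_planeWave_mul {f : RR d → ℂ} (hf : MemLp f 2 (cellMeasure d)) :
    HasSum (fun k => ‖∫ y, planeWave (-freq k) y * f y ∂(cellMeasure d)‖ ^ 2)
      (∫ y, ‖f y‖ ^ 2 ∂(cellMeasure d)) := by
  have hF : MemLp (fun x => f (fromTorus x)) 2 (torusMeasure d) :=
    hf.comp_measurePreserving (measurePreserving_fromTorus d)
  have hcoeff (k : Fin d → ℤ) : UnitAddTorus.mFourierCoeff (MemLp.toLp _ hF) k
      = ∫ y, planeWave (-freq k) y * f y ∂(cellMeasure d) := by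
    rw [← integral_comp_fromTorus (f := fun y => planeWave (-freq k) y * f y)
      ((continuous_planeWave _).aestronglyMeasurable.mul hf.1)]
    refine integral_congr_ae ?_
    filter_upwards [hF.coeFn_toLp] with x hx
    rw [hx, smul_eq_mul, UnitAddTorus.mFourier_neg]
    conv_lhs => rw [← toTorus_fromTorus x, mFourier_toTorus, conj_planeWave, toTorus_fromTorus]
  have hnorm : ∫ x, ‖MemLp.toLp _ hF x‖ ^ 2 ∂(torusMeasure d)
      = ∫ y, ‖f y‖ ^ 2 ∂(cellMeasure d) := by
    rw [← integral_comp_fromTorus (f := fun y => ‖f y‖ ^ 2) (hf.1.norm.pow 2)]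
    refine integral_congr_ae ?_
    filter_upwards [hF.coeFn_toLp] with x hx
    rw [hx]
  simp only [← hcoeff, ← hnorm]
  exact UnitAddTorus.hasSum_sq_mFourierCoeff (MemLp.toLp _ hF)

variable {ι : Type*} [Fintype ι]

lemma mean_modulate_apply (θ : RR d) (u : Lp (EuclideanSpace ℂ ι) 2 (cellMeasure d)) (i : ι) :
    mean (modulate θ u) i = ∫ y, planeWave θ y * u y i ∂(cellMeasure d) := by
  rw [mean_eq_integral, eval_integral_piLp fun i =>
    ((Lp.memLp (modulate θ u)).integrable one_le_two).eval_piLp i]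
  refine integral_congr_ae ?_
  filter_upwards [coeFn_modulate θ u] with y hy
  rw [hy, PiLp.smul_apply, smul_eq_mul]

lemma hasSum_sq_norm_mean_modulate (u : Lp (EuclideanSpace ℂ ι) 2 (cellMeasure d)) :
    HasSum (fun k => ‖mean (modulate (-freq k) u)‖ ^ 2) (‖u‖ ^ 2) := by
  have hu (i : ι) : MemLp (fun y => u y i) 2 (cellMeasure d) := (Lp.memLp u).eval_piLp i
  convert hasSum_sum fun i (_ : i ∈ Finset.univ) =>
    hasSum_sq_norm_integral_planeWave_mul (hu i) using 1
  · simp only [EuclideanSpace.norm_sq_eq, mean_modulate_apply]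
  · rw [norm_sq_eq_integral_norm_sq,
      ← integral_finsetSum _ fun i _ => (hu i).integrable_norm_pow two_ne_zero]
    simp only [EuclideanSpace.norm_sq_eq]

end Parseval

section ShiftedGradient

variable {n d : ℕ}

/-- The map `x ↦ i x ⊗ θ` from `ℂ^n` to `ℂ^{n×d}`, the gradient of `x e^{i⟨θ,y⟩}` at `y = 0`. -/
def tensor (n : ℕ) (θ : RR d) : CVec n →L[ℂ] CMat n d :=
  LinearMap.toContinuousLinearMap
    { toFun := fun x => WithLp.toLp 2 fun ij => Complex.I * θ ij.2 * x ij.1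
      map_add' := fun x y => by ext ij; simp [mul_add]
      map_smul' := fun c x => by ext ij; simp; ring }

lemma tensor_apply (θ : RR d) (x : CVec n) (ij : Fin n × Fin d) :
    tensor n θ x ij = Complex.I * θ ij.2 * x ij.1 := rfl

lemma tensor_add (θ η : RR d) : tensor n (θ + η) = tensor n θ + tensor n η := by
  ext x ij
  simp only [tensor_apply, add_apply, PiLp.add_apply, Complex.ofReal_add]
  ring

lemma norm_tensor_apply (θ : RR d) (x : CVec n) : ‖tensor n θ x‖ = ‖θ‖ * ‖x‖ := by
  rw [← sq_eq_sq₀ (norm_nonneg _) (by positivity), mul_pow, EuclideanSpace.norm_sq_eq,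
    EuclideanSpace.norm_sq_eq, EuclideanSpace.norm_sq_eq, Finset.sum_mul_sum,
    Fintype.sum_prod_type_right]
  simp [tensor_apply, mul_pow]

/-- The operator `(u, grad u) ↦ grad u + i u ⊗ θ`, which is `e^{-i⟨θ,·⟩} grad (e^{i⟨θ,·⟩} u)`. -/
def shiftedGrad (n : ℕ) (θ : RR d) : (L2Vec n d × L2Mat n d) →L[ℂ] L2Mat n d :=
  ContinuousLinearMap.snd ℂ _ _ +
    ((tensor n θ).compLpL 2 (cellMeasure d)).comp (ContinuousLinearMap.fst ℂ _ _)

lemma shiftedGrad_apply (θ : RR d) (w : L2Vec n d × L2Mat n d) :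
    shiftedGrad n θ w = w.2 + (tensor n θ).compLpL 2 _ w.1 := rfl

lemma shiftedGrad_add (θ η : RR d) (w : L2Vec n d × L2Mat n d) :
    shiftedGrad n (θ + η) w = shiftedGrad n θ w + (tensor n η).compLpL 2 _ w.1 := by
  rw [shiftedGrad_apply, shiftedGrad_apply, tensor_add, ContinuousLinearMap.add_compLpL,
    add_apply, add_assoc]

lemma shiftedGrad_zero (w : L2Vec n d × L2Mat n d) : shiftedGrad n 0 w = w.2 := by
  have h := shiftedGrad_add 0 0 w
  rw [add_zero, left_eq_add] at h
  rw [shiftedGrad_apply, h, add_zero]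

lemma norm_shiftedGrad_sub_le (θ η : RR d) (w : L2Vec n d × L2Mat n d) :
    ‖shiftedGrad n θ w - shiftedGrad n η w‖ ≤ ‖θ - η‖ * ‖w.1‖ := by
  rw [← add_sub_cancel η θ, shiftedGrad_add, add_sub_cancel_left, add_sub_cancel_left]
  refine ((tensor n (θ - η)).norm_compLp_le w.1).trans ?_
  gcongr
  exact ContinuousLinearMap.opNorm_le_bound _ (norm_nonneg _) fun x => (norm_tensor_apply _ x).le

/-- The map `(u, grad u) ↦ (v, grad v)` with `v = e^{i⟨θ,·⟩} u`. -/
def gaugeShift (n : ℕ) (θ : RR d) : (L2Vec n d × L2Mat n d) →L[ℂ] (L2Vec n d × L2Mat n d) :=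
  ((modulate θ).toContinuousLinearMap.comp (ContinuousLinearMap.fst ℂ _ _)).prod
    ((modulate θ).toContinuousLinearMap.comp (shiftedGrad n θ))

lemma gaugeShift_fst (θ : RR d) (w : L2Vec n d × L2Mat n d) :
    (gaugeShift n θ w).1 = modulate θ w.1 := rfl

lemma gaugeShift_snd (θ : RR d) (w : L2Vec n d × L2Mat n d) :
    (gaugeShift n θ w).2 = modulate θ (shiftedGrad n θ w) := rfl

lemma gaugeShift_gaugeShift (θ η : RR d) (w : L2Vec n d × L2Mat n d) :
    gaugeShift n θ (gaugeShift n η w) = gaugeShift n (η + θ) w := by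
  refine Prod.ext ?_ ?_
  · simp only [gaugeShift_fst, modulate_modulate, add_comm]
  · rw [gaugeShift_snd, gaugeShift_snd, shiftedGrad_add, add_comm η, ← modulate_modulate,
      shiftedGrad_apply, gaugeShift_fst, gaugeShift_snd, map_add (modulate η), modulate_compLpL]

lemma gaugeShift_zero (w : L2Vec n d × L2Mat n d) : gaugeShift n 0 w = w :=
  Prod.ext (modulate_zero w.1) (by rw [gaugeShift_snd, modulate_zero, shiftedGrad_zero])

end ShiftedGradient

section QuasiPeriodic

variable {n d : ℕ}

lemma classicalGrad_apply (φ : RR d → CVec n) (y : RR d) (ij : Fin n × Fin d) :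
    classicalGrad φ y ij = fderiv ℝ φ y (EuclideanSpace.single ij.2 1) ij.1 := rfl

lemma IsSmoothQuasiPeriodic.differentiableAt {θ : RR d} {φ : RR d → CVec n}
    (h : IsSmoothQuasiPeriodic θ φ) (y : RR d) : DifferentiableAt ℝ φ y :=
  (h.contDiff.differentiable (by simp)) y

lemma fderiv_planeWave_smul (θ : RR d) {φ : RR d → CVec n} {y : RR d}
    (h : DifferentiableAt ℝ φ y) (z : RR d) :
    fderiv ℝ (fun y => planeWave θ y • φ y) y z
      = planeWave θ y • (fderiv ℝ φ y z + (Complex.I * (inner ℝ θ z : ℝ)) • φ y) := by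
  have hsmul : HasFDerivAt (fun y => planeWave θ y • φ y) _ y :=
    (hasFDerivAt_planeWave θ y).smul h.hasFDerivAt
  rw [hsmul.fderiv]
  simp [smul_smul, mul_assoc]

lemma classicalGrad_planeWave_smul (θ : RR d) {φ : RR d → CVec n} {y : RR d}
    (h : DifferentiableAt ℝ φ y) :
    classicalGrad (fun y => planeWave θ y • φ y) y
      = planeWave θ y • (classicalGrad φ y + tensor n θ (φ y)) := by
  ext ij
  have hθ : inner ℝ θ (EuclideanSpace.single ij.2 (1 : ℝ)) = θ ij.2 := by
    simp [EuclideanSpace.inner_single_right]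
  rw [classicalGrad_apply, fderiv_planeWave_smul θ h, hθ]
  rfl

lemma IsSmoothQuasiPeriodic.planeWave_smul {η : RR d} {φ : RR d → CVec n}
    (h : IsSmoothQuasiPeriodic η φ) (θ : RR d) :
    IsSmoothQuasiPeriodic (θ + η) fun y => planeWave θ y • φ y where
  contDiff := (contDiff_planeWave θ).smul h.contDiff
  quasiPeriodic k y := by
    rw [h.quasiPeriodic, planeWave_add_right, planeWave_add_left, smul_smul, smul_smul]
    ring_nf

lemma isSmoothQuasiPeriodic_add_freq_iff {θ : RR d} {k : Fin d → ℤ} {φ : RR d → CVec n} :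
    IsSmoothQuasiPeriodic (θ + freq k) φ ↔ IsSmoothQuasiPeriodic θ φ := by
  have h (m : Fin d → ℤ) : planeWave (θ + freq k) (intVec m) = planeWave θ (intVec m) := by
    rw [planeWave_add_left, planeWave_freq_intVec, mul_one]
  exact ⟨fun hφ => ⟨hφ.1, by simpa only [h] using hφ.2⟩,
    fun hφ => ⟨hφ.1, by simpa only [h] using hφ.2⟩⟩

lemma H1_add_freq (n : ℕ) (θ : RR d) (k : Fin d → ℤ) : H1 n (θ + freq k) = H1 n θ := by
  simp only [H1, smoothGraph, isSmoothQuasiPeriodic_add_freq_iff]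

/-- The graph of `grad_θ` on `[C^∞_θ(Y)]^n`, as a subspace of `[L²(Y)]^n × [L²(Y)]^{n×d}`. -/
def smoothSubmodule (n : ℕ) {d : ℕ} (θ : RR d) : Submodule ℂ (L2Vec n d × L2Mat n d) where
  carrier := smoothGraph n θ
  zero_mem' := by
    refine ⟨0, ⟨contDiff_const, fun k y => by simp⟩, Lp.coeFn_zero _ _ _, ?_⟩
    refine (Lp.coeFn_zero _ _ _).trans (.of_forall fun y => ?_)
    ext ij
    simp [classicalGrad_apply]
  add_mem' := by
    rintro v w ⟨φ, hφ, hv, hgradv⟩ ⟨ψ, hψ, hw, hgradw⟩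
    refine ⟨φ + ψ, ⟨hφ.contDiff.add hψ.contDiff, fun k y => ?_⟩, ?_, ?_⟩
    · simp [hφ.quasiPeriodic, hψ.quasiPeriodic]
    · exact (Lp.coeFn_add _ _).trans (hv.add hw)
    · refine ((Lp.coeFn_add _ _).trans (hgradv.add hgradw)).trans (.of_forall fun y => ?_)
      ext ij
      simp [classicalGrad_apply, fderiv_add (hφ.differentiableAt y) (hψ.differentiableAt y)]
  smul_mem' := by
    rintro c w ⟨φ, hφ, hw, hgrad⟩
    refine ⟨c • φ, ⟨contDiff_const.smul hφ.contDiff, fun k y => ?_⟩, ?_, ?_⟩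
    · simp [hφ.quasiPeriodic, smul_comm c]
    · exact (Lp.coeFn_smul _ _).trans (hw.const_smul c)
    · refine ((Lp.coeFn_smul _ _).trans (hgrad.const_smul c)).trans (.of_forall fun y => ?_)
      ext ij
      simp [classicalGrad_apply, fderiv_const_smul (hφ.differentiableAt y)]

lemma gaugeShift_mem_smoothGraph (θ : RR d) {η : RR d} {w : L2Vec n d × L2Mat n d}
    (hw : w ∈ smoothGraph n η) : gaugeShift n θ w ∈ smoothGraph n (θ + η) := by
  obtain ⟨φ, hφ, hu, hgrad⟩ := hw
  refine ⟨_, hφ.planeWave_smul θ, ?_, ?_⟩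
  · filter_upwards [coeFn_modulate θ w.1, hu] with y hmod huy
    rw [gaugeShift_fst, hmod, huy]
  · filter_upwards [coeFn_modulate θ (shiftedGrad n θ w), hu, hgrad,
      Lp.coeFn_add w.2 ((tensor n θ).compLpL 2 _ w.1), (tensor n θ).coeFn_compLpL w.1]
      with y hmod huy hgrady hadd htensor
    rw [gaugeShift_snd, hmod, shiftedGrad_apply, hadd, Pi.add_apply, htensor, huy, hgrady,
      classicalGrad_planeWave_smul θ (hφ.differentiableAt y)]

lemma gaugeShift_mem_H1 (θ : RR d) {η : RR d} {w : L2Vec n d × L2Mat n d}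
    (hw : w ∈ H1 n η) : gaugeShift n θ w ∈ H1 n (θ + η) :=
  map_mem_closure (gaugeShift n θ).continuous hw fun _ => gaugeShift_mem_smoothGraph θ

lemma mem_H1perp_iff {θ : RR d} {w : L2Vec n d × L2Mat n d} :
    w ∈ H1perp n θ ↔ w ∈ H1 n θ ∧ mean (modulate (-θ) w.1) = 0 := by
  refine and_congr_right fun _ => ?_
  simp only [PiLp.ext_iff, mean_modulate_apply, PiLp.zero_apply, conj_planeWave, mul_comm]

lemma gaugeShift_mem_H1perp (θ : RR d) {η : RR d} {w : L2Vec n d × L2Mat n d}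
    (hw : w ∈ H1perp n η) : gaugeShift n θ w ∈ H1perp n (θ + η) := by
  rw [mem_H1perp_iff] at hw ⊢
  refine ⟨gaugeShift_mem_H1 θ hw.1, ?_⟩
  rw [gaugeShift_fst, modulate_modulate, neg_add_rev, neg_add_cancel_right, hw.2]

end QuasiPeriodic

section Poincare

variable {n d : ℕ}

lemma mean_classicalGrad_eq_zero {w : L2Vec n d × L2Mat n d} (hw : w ∈ smoothGraph n 0) :
    mean w.2 = 0 := by
  obtain ⟨φ, hφ, -, hgrad⟩ := hw
  have hφ1 : ContDiff ℝ 1 φ := hφ.contDiff.of_le (by exact_mod_cast le_top)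
  have hper (k : Fin d → ℤ) (y : RR d) : φ (y + intVec k) = φ y := by
    rw [hφ.quasiPeriodic, planeWave_zero_left, one_smul]
  ext ij
  set z : RR d := EuclideanSpace.single ij.2 1
  have hz : Integrable (fun y => fderiv ℝ φ y z) (cellMeasure d) :=
    integrable_cell_of_continuous
      ((hφ1.continuous_fderiv one_ne_zero).clm_apply continuous_const)
  calc mean w.2 ij = ∫ y, fderiv ℝ φ y z ij.1 ∂(cellMeasure d) := by
        rw [mean_eq_integral, eval_integral_piLp fun i =>
          ((Lp.memLp w.2).integrable one_le_two).eval_piLp i]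
        refine integral_congr_ae ?_
        filter_upwards [hgrad] with y hy
        rw [hy, classicalGrad_apply]
    _ = (∫ y, fderiv ℝ φ y z ∂(cellMeasure d)) ij.1 :=
        (eval_integral_piLp (fun i => hz.eval_piLp i) ij.1).symm
    _ = 0 := by rw [integral_cell_fderiv_eq_zero hφ1 hper, PiLp.zero_apply]

lemma mean_snd_eq_zero_of_mem_H1 {w : L2Vec n d × L2Mat n d} (hw : w ∈ H1 n 0) :
    mean w.2 = 0 :=
  closure_minimal (fun _ => mean_classicalGrad_eq_zero)
    (isClosed_eq (mean.continuous.comp continuous_snd) continuous_const) hw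

/-- Multiplication by the periodic function `e^{-i⟨2πk,·⟩}` preserves `[H^1_0(Y)]^n`, and turns the
Fourier coefficient of index `k` into a mean value. -/
lemma mean_modulate_shiftedGrad (θ : RR d) (k : Fin d → ℤ) {w : L2Vec n d × L2Mat n d}
    (hw : w ∈ H1 n 0) :
    mean (modulate (-freq k) (shiftedGrad n θ w))
      = tensor n (θ + freq k) (mean (modulate (-freq k) w.1)) := by
  have hmem : gaugeShift n (-freq k) w ∈ H1 n 0 := by
    have h := gaugeShift_mem_H1 (-freq k) hw
    rwa [add_zero, ← H1_add_freq n (-freq k) k, neg_add_cancel] at h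
  have hmean := mean_snd_eq_zero_of_mem_H1 hmem
  have hsplit : shiftedGrad n θ w
      = shiftedGrad n (-freq k) w + (tensor n (θ + freq k)).compLpL 2 _ w.1 := by
    rw [← shiftedGrad_add, add_comm θ, neg_add_cancel_left]
  rw [gaugeShift_snd] at hmean
  rw [hsplit, map_add, map_add, hmean, zero_add, modulate_compLpL, mean_compLpL]

lemma pi_le_norm_add_freq {θ : RR d} (hθ : ∀ j, |θ j| ≤ Real.pi) {k : Fin d → ℤ} (hk : k ≠ 0) :
    Real.pi ≤ ‖θ + freq k‖ := by
  obtain ⟨j, hj⟩ := Function.ne_iff.1 hk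
  have hk1 : (1 : ℝ) ≤ |(k j : ℝ)| := by exact_mod_cast Int.one_le_abs hj
  have hfreq : 2 * Real.pi ≤ |freq k j| := by
    rw [freq_apply, abs_mul, abs_of_pos Real.two_pi_pos]
    exact le_mul_of_one_le_right Real.two_pi_pos.le hk1
  calc Real.pi ≤ |freq k j| - |θ j| := by linarith [hθ j]
    _ ≤ |(θ + freq k) j| := by
        rw [PiLp.add_apply, add_comm]
        exact abs_sub_abs_le_abs_add _ _
    _ ≤ ‖θ + freq k‖ := PiLp.norm_apply_le (θ + freq k) j

theorem pi_mul_norm_fst_le_norm_shiftedGrad {θ : RR d} (hθ : ∀ j, |θ j| ≤ Real.pi)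
    {w : L2Vec n d × L2Mat n d} (hw : w ∈ H1 n 0) (hmean : mean w.1 = 0) :
    Real.pi * ‖w.1‖ ≤ ‖shiftedGrad n θ w‖ := by
  rw [← sq_le_sq₀ (by positivity) (norm_nonneg _), mul_pow]
  refine hasSum_le (fun k => ?_) ((hasSum_sq_norm_mean_modulate w.1).mul_left _)
    (hasSum_sq_norm_mean_modulate (shiftedGrad n θ w))
  rw [mean_modulate_shiftedGrad θ k hw, norm_tensor_apply, ← mul_pow]
  obtain rfl | hk := eq_or_ne k 0
  · simp [freq_zero, modulate_zero, hmean]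
  · gcongr
    exact pi_le_norm_add_freq hθ hk

end Poincare

section FibreProblem

variable {n d : ℕ}

lemma abs_le_pi_of_mem_Theta {θ : RR d} (hθ : θ ∈ Theta d) (j : Fin d) : |θ j| ≤ Real.pi :=
  abs_le.2 ⟨(hθ j).1, (hθ j).2.le⟩

/-- The pairs `(u, grad u)` with `u ∈ [H^1_0(Y)]^n` of zero mean. Multiplication by `e^{i⟨θ,·⟩}`
identifies this space, which does not depend on `θ`, with `[H^1_θ(Y) ⊥ e^{i⟨θ,·⟩}]^n`. -/
def zeroMeanH1 (n d : ℕ) : Submodule ℂ (L2Vec n d × L2Mat n d) :=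
  (smoothSubmodule n 0).topologicalClosure ⊓
    LinearMap.ker (mean.comp (ContinuousLinearMap.fst ℂ (L2Vec n d) (L2Mat n d))).toLinearMap

lemma coe_zeroMeanH1 : (zeroMeanH1 n d : Set (L2Vec n d × L2Mat n d)) = H1perp n 0 := by
  ext w
  rw [mem_H1perp_iff, neg_zero, modulate_zero]
  rfl

instance : CompleteSpace (zeroMeanH1 n d) :=
  ((smoothSubmodule n 0).isClosed_topologicalClosure.inter
    (ContinuousLinearMap.isClosed_ker _)).completeSpace_coe

lemma image_gaugeShift_zeroMeanH1 (n : ℕ) (θ : RR d) :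
    gaugeShift n θ '' zeroMeanH1 n d = H1perp n θ := by
  rw [coe_zeroMeanH1]
  refine Set.Subset.antisymm ?_ fun w hw => ⟨gaugeShift n (-θ) w, ?_, ?_⟩
  · rintro _ ⟨w, hw, rfl⟩
    simpa only [add_zero] using gaugeShift_mem_H1perp θ hw
  · simpa only [neg_add_cancel] using gaugeShift_mem_H1perp (-θ) hw
  · rw [gaugeShift_gaugeShift, neg_add_cancel, gaugeShift_zero]

/-- The operator `u ↦ grad u + i u ⊗ θ` on the periodic functions of zero mean. -/
def fibreGrad (n : ℕ) (θ : RR d) : zeroMeanH1 n d →L[ℂ] L2Mat n d :=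
  (shiftedGrad n θ).comp (zeroMeanH1 n d).subtypeL

lemma pi_mul_norm_fst_le_norm_fibreGrad {θ : RR d} (hθ : ∀ j, |θ j| ≤ Real.pi)
    (v : zeroMeanH1 n d) : Real.pi * ‖v.1.1‖ ≤ ‖fibreGrad n θ v‖ :=
  pi_mul_norm_fst_le_norm_shiftedGrad hθ v.2.1 v.2.2

lemma norm_fibreGrad_sub_le {θ : RR d} (hθ : ∀ j, |θ j| ≤ Real.pi) (η ζ : RR d)
    (v : zeroMeanH1 n d) :
    ‖fibreGrad n η v - fibreGrad n ζ v‖ ≤ ‖η - ζ‖ / Real.pi * ‖fibreGrad n θ v‖ := by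
  refine (norm_shiftedGrad_sub_le η ζ v.1).trans ?_
  rw [div_mul_eq_mul_div, mul_div_assoc]
  gcongr
  rw [le_div_iff₀' Real.pi_pos]
  exact pi_mul_norm_fst_le_norm_fibreGrad hθ v

lemma antilipschitzWith_fibreGrad {θ : RR d} (hθ : ∀ j, |θ j| ≤ Real.pi) :
    AntilipschitzWith (1 + ‖θ‖₊) (fibreGrad n θ) := by
  refine (fibreGrad n θ).antilipschitz_of_bound fun v => ?_
  have hfst : ‖v.1.1‖ ≤ ‖fibreGrad n θ v‖ :=
    (le_mul_of_one_le_left (norm_nonneg _) (by linarith [Real.pi_gt_three])).trans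
      (pi_mul_norm_fst_le_norm_fibreGrad hθ v)
  have hsnd : ‖fibreGrad n θ v - v.1.2‖ ≤ ‖θ‖ * ‖fibreGrad n θ v‖ := by
    have h := norm_shiftedGrad_sub_le θ 0 v.1
    rw [shiftedGrad_zero, sub_zero] at h
    exact h.trans (by gcongr)
  rw [NNReal.coe_add, NNReal.coe_one, coe_nnnorm, add_mul, one_mul]
  exact max_le (hfst.trans (le_add_of_nonneg_right (by positivity)))
    ((norm_le_norm_add_norm_sub (fibreGrad n θ v) v.1.2).trans (by gcongr))

variable {a : RR d → (CMat n d →L[ℂ] CMat n d)}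

lemma integral_inner_apply_add_planeWave_smul (ha : MemLp a ⊤ (cellMeasure d)) (θ : RR d)
    (u w : L2Mat n d) (X : CMat n d) :
    ∫ y, inner ℂ (u y) (a y (w y + planeWave θ y • X)) ∂(cellMeasure d)
      = inner ℂ u (mulOp a ha (w + modulate θ (Lp.const 2 _ X))) := by
  rw [L2.inner_def]
  refine integral_congr_ae ?_
  filter_upwards [coeFn_mulOp ha (w + modulate θ (Lp.const 2 _ X)),
    Lp.coeFn_add w (modulate θ (Lp.const 2 _ X)), coeFn_modulate θ (Lp.const 2 _ X),
    Lp.coeFn_const 2 (cellMeasure d) X] with y hmul hadd hmod hconst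
  rw [hmul, hadd, Pi.add_apply, hmod, hconst, Function.const_apply]

lemma isCellSolution_gaugeShift_iff (ha : MemLp a ⊤ (cellMeasure d)) {θ : RR d} {r : Fin n}
    {s : Fin d} (v : zeroMeanH1 n d) :
    IsCellSolution a θ r s (gaugeShift n θ v) ↔ ∀ φ : zeroMeanH1 n d,
      inner ℂ (fibreGrad n θ φ)
        (mulOp a ha (fibreGrad n θ v + Lp.const 2 _ (unitMat r s))) = 0 := by
  rw [IsCellSolution, ← image_gaugeShift_zeroMeanH1, Set.forall_mem_image,
    and_iff_right (Set.mem_image_of_mem _ v.2)]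
  simp only [integral_inner_apply_add_planeWave_smul ha, gaugeShift_snd, ← map_add,
    mulOp_modulate, LinearIsometry.inner_map_map, Subtype.forall]
  rfl

theorem existsUnique_isCellSolution (ha : MemLp a ⊤ (cellMeasure d)) {ν : ℝ} (hν : 0 < ν)
    (hcoer : ∀ᵐ y ∂(cellMeasure d), ∀ X, ν * ‖X‖ ^ 2 ≤ (inner ℂ X (a y X)).re) {θ : RR d}
    (hθ : ∀ j, |θ j| ≤ Real.pi) (r : Fin n) (s : Fin d) : ∃! N, IsCellSolution a θ r s N := by
  obtain ⟨v, hv, huniq⟩ := existsUnique_forall_inner_map_add_eq_zero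
    (antilipschitzWith_fibreGrad hθ) hν (mul_norm_sq_le_re_inner_mulOp ha hcoer)
    (Lp.const 2 _ (unitMat r s))
  refine ⟨gaugeShift n θ v, (isCellSolution_gaugeShift_iff ha v).2 hv, fun N hN => ?_⟩
  obtain ⟨w, hw, rfl⟩ := (image_gaugeShift_zeroMeanH1 n θ).superset hN.1
  rw [← huniq ⟨w, hw⟩ ((isCellSolution_gaugeShift_iff ha ⟨w, hw⟩).1 hN)]

end FibreProblem

section HomogenisedTensor

variable {n d : ℕ} {a : RR d → (CMat n d →L[ℂ] CMat n d)}

lemma sum_smul_unitMat (X : CMat n d) : ∑ rs, X rs • unitMat rs.1 rs.2 = X := by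
  have h := (EuclideanSpace.basisFun (Fin n × Fin d) ℂ).sum_repr X
  simp only [EuclideanSpace.basisFun_apply, EuclideanSpace.basisFun_repr] at h
  exact h

lemma apply_eq_sum_coeffEntry (y : RR d) (X : CMat n d) (ij : Fin n × Fin d) :
    a y X ij = ∑ k, ∑ l, coeffEntry a ij.1 ij.2 k l y * X (k, l) := by
  conv_lhs => rw [← sum_smul_unitMat X, map_sum]
  simp only [map_smul, WithLp.ofLp_sum, Finset.sum_apply, PiLp.smul_apply, smul_eq_mul,
    Fintype.sum_prod_type, coeffEntry, mul_comm]

lemma mean_mulOp_apply (ha : MemLp a ⊤ (cellMeasure d)) (F : L2Mat n d) (ij : Fin n × Fin d) :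
    mean (mulOp a ha F) ij
      = ∑ k, ∑ l, ∫ y, coeffEntry a ij.1 ij.2 k l y * F y (k, l) ∂(cellMeasure d) := by
  have hint (k : Fin n) (l : Fin d) :
      Integrable (fun y => coeffEntry a ij.1 ij.2 k l y * F y (k, l)) (cellMeasure d) := by
    have hentry : MemLp (coeffEntry a ij.1 ij.2 k l) ⊤ (cellMeasure d) :=
      ((EuclideanSpace.proj (𝕜 := ℂ) ij).comp
        (ContinuousLinearMap.apply ℂ (CMat n d) (unitMat k l))).comp_memLp' ha
    exact (((Lp.memLp F).eval_piLp (k, l)).mul hentry).integrable one_le_two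
  rw [mean_eq_integral, eval_integral_piLp fun i =>
    ((Lp.memLp (mulOp a ha F)).integrable one_le_two).eval_piLp i]
  simp_rw [← integral_finsetSum _ fun l _ => hint _ l]
  rw [← integral_finsetSum _ fun k _ => integrable_finsetSum _ fun l _ => hint k l]
  refine integral_congr_ae ?_
  filter_upwards [coeFn_mulOp ha F] with y hy
  rw [hy, apply_eq_sum_coeffEntry]

lemma ahomMatrix_eq_mean (ha : MemLp a ⊤ (cellMeasure d)) {θ : RR d} {ij rs : Fin n × Fin d}
    {v : zeroMeanH1 n d} (hv : cellSolution a θ rs.1 rs.2 = gaugeShift n θ v) :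
    ahomMatrix a θ ij rs
      = mean (mulOp a ha (fibreGrad n θ v + Lp.const 2 _ (unitMat rs.1 rs.2))) ij := by
  rw [mean_mulOp_apply, ahomMatrix, hv]
  refine Finset.sum_congr rfl fun k _ => Finset.sum_congr rfl fun l _ => integral_congr_ae ?_
  filter_upwards [coeFn_modulate θ (fibreGrad n θ v),
    Lp.coeFn_add (fibreGrad n θ v) (Lp.const 2 _ (unitMat rs.1 rs.2)),
    Lp.coeFn_const 2 (cellMeasure d) (unitMat rs.1 rs.2)] with y hmod hadd hconst
  have hunit : (unitMat rs.1 rs.2 : CMat n d) (k, l)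
      = (if k = rs.1 then 1 else 0) * (if l = rs.2 then 1 else 0) := by
    simp only [unitMat, PiLp.single_apply, Prod.ext_iff, ite_and]
    split_ifs <;> simp
  have hwave : planeWave θ y * planeWave (-θ) y = 1 := by
    rw [← planeWave_add_left, add_neg_cancel, planeWave_zero_left]
  have hgrad : (gaugeShift n θ v).2 y = planeWave θ y • fibreGrad n θ v y := hmod
  rw [hgrad, hadd, Pi.add_apply, hconst, Function.const_apply, PiLp.add_apply, PiLp.smul_apply,
    hunit, smul_eq_mul]
  linear_combination coeffEntry a ij.1 ij.2 k l y * (fibreGrad n θ v y (k, l) +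
    (if k = rs.1 then 1 else 0) * (if l = rs.2 then 1 else 0)) * hwave

lemma ahom_apply (θ : RR d) (X : CMat n d) (ij : Fin n × Fin d) :
    ahom a θ X ij = ∑ rs, ahomMatrix a θ ij rs * X rs := rfl

/-- By linearity the cell problems for the matrix units add up to one for every matrix `X`, whose
flux has mean `a^hom(θ) X`. -/
theorem exists_corrector (ha : MemLp a ⊤ (cellMeasure d)) {ν : ℝ} (hν : 0 < ν)
    (hcoer : ∀ᵐ y ∂(cellMeasure d), ∀ X, ν * ‖X‖ ^ 2 ≤ (inner ℂ X (a y X)).re) {θ : RR d}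
    (hθ : ∀ j, |θ j| ≤ Real.pi) (X : CMat n d) :
    ∃ v, (∀ φ, inner ℂ (fibreGrad n θ φ) (mulOp a ha (fibreGrad n θ v + Lp.const 2 _ X)) = 0) ∧
      ahom a θ X = mean (mulOp a ha (fibreGrad n θ v + Lp.const 2 _ X)) := by
  have hsol (rs : Fin n × Fin d) :
      IsCellSolution a θ rs.1 rs.2 (cellSolution a θ rs.1 rs.2) :=
    Classical.epsilon_spec (existsUnique_isCellSolution ha hν hcoer hθ rs.1 rs.2).exists
  have hshift (rs : Fin n × Fin d) :
      ∃ v : zeroMeanH1 n d, cellSolution a θ rs.1 rs.2 = gaugeShift n θ v := by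
    obtain ⟨v, hv, h⟩ := (image_gaugeShift_zeroMeanH1 n θ).superset (hsol rs).1
    exact ⟨⟨v, hv⟩, h.symm⟩
  choose v hv using hshift
  have hfield : fibreGrad n θ (∑ rs, X rs • v rs) + Lp.const 2 _ X
      = ∑ rs, X rs • (fibreGrad n θ (v rs) + Lp.const 2 _ (unitMat rs.1 rs.2)) := by
    have hX : Lp.const 2 (cellMeasure d) X
        = ∑ rs, X rs • Lp.const 2 (cellMeasure d) (unitMat rs.1 rs.2) := by
      conv_lhs => rw [← sum_smul_unitMat X]
      rw [map_sum]
      exact Finset.sum_congr rfl fun rs _ => map_smul (Lp.constₗ 2 (cellMeasure d) ℂ) _ _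
    simp only [hX, map_sum, map_smul, smul_add, Finset.sum_add_distrib]
  refine ⟨∑ rs, X rs • v rs, fun φ => ?_, ?_⟩
  · rw [hfield, map_sum, inner_sum]
    refine Finset.sum_eq_zero fun rs _ => ?_
    rw [map_smul, inner_smul_right,
      (isCellSolution_gaugeShift_iff ha (v rs)).1 (hv rs ▸ hsol rs) φ, mul_zero]
  · ext ij
    rw [hfield, ahom_apply, map_sum, map_sum, WithLp.ofLp_sum, Finset.sum_apply]
    refine Finset.sum_congr rfl fun rs _ => ?_
    rw [map_smul, map_smul, PiLp.smul_apply, smul_eq_mul, ahomMatrix_eq_mean ha (hv rs), mul_comm]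

theorem norm_ahom_sub_le (ha : MemLp a ⊤ (cellMeasure d)) {ν : ℝ} (hν : 0 < ν)
    (hcoer : ∀ᵐ y ∂(cellMeasure d), ∀ X, ν * ‖X‖ ^ 2 ≤ (inner ℂ X (a y X)).re) {θ η : RR d}
    (hθ : ∀ j, |θ j| ≤ Real.pi) (hη : ∀ j, |η j| ≤ Real.pi) :
    ‖ahom a θ - ahom a η‖ ≤ ‖mulOp a ha‖ *
      (2 * (‖mulOp a ha‖ / ν) * (1 + ‖mulOp a ha‖ / ν) * (‖θ - η‖ / Real.pi)) := by
  refine ContinuousLinearMap.opNorm_le_bound _ (by positivity) fun X => ?_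
  obtain ⟨v, hv, hahomθ⟩ := exists_corrector ha hν hcoer hθ X
  obtain ⟨w, hw, hahomη⟩ := exists_corrector ha hν hcoer hη X
  have hfield := norm_map_add_sub_map_add_le hν (mul_norm_sq_le_re_inner_mulOp ha hcoer)
    (by positivity) (norm_fibreGrad_sub_le hθ θ η) (norm_fibreGrad_sub_le hη θ η) hv hw
  rw [norm_const_eq] at hfield
  rw [sub_apply, hahomθ, hahomη, ← map_sub, ← map_sub, mul_assoc]
  exact (norm_mean_le _).trans ((ContinuousLinearMap.le_opNorm _ _).trans (by gcongr))

end HomogenisedTensor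

end

end FibreHom

theorem proposition4p3_general {n d : ℕ}
    {a : FibreHom.RR d → (FibreHom.CMat n d →L[ℂ] FibreHom.CMat n d)}
    (ha : MemLp a ⊤ (FibreHom.cellMeasure d)) {ν : ℝ} (hν : 0 < ν)
    (hcoer : ∀ᵐ y ∂(FibreHom.cellMeasure d), ∀ X, ν * ‖X‖ ^ 2 ≤ (inner ℂ X (a y X)).re) :
    (∀ θ : FibreHom.RR d, (∀ j, |θ j| ≤ Real.pi) → ∀ (r : Fin n) (s : Fin d),
        ∃! N, FibreHom.IsCellSolution a θ r s N) ∧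
      ∃ κ : ℝ, 0 < κ ∧ ∀ θ η : FibreHom.RR d, (∀ j, |θ j| ≤ Real.pi) → (∀ j, |η j| ≤ Real.pi) →
        ‖FibreHom.ahom a θ - FibreHom.ahom a η‖ ≤ κ * ‖θ - η‖ := by
  refine ⟨fun θ hθ => FibreHom.existsUnique_isCellSolution ha hν hcoer hθ, ?_⟩
  set M := ‖FibreHom.mulOp a ha‖
  refine ⟨M * (2 * (M / ν) * (1 + M / ν) / Real.pi) + 1, by positivity, fun θ η hθ hη => ?_⟩
  calc ‖FibreHom.ahom a θ - FibreHom.ahom a η‖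
      ≤ M * (2 * (M / ν) * (1 + M / ν) * (‖θ - η‖ / Real.pi)) :=
        FibreHom.norm_ahom_sub_le ha hν hcoer hθ hη
    _ = M * (2 * (M / ν) * (1 + M / ν) / Real.pi) * ‖θ - η‖ := by ring
    _ ≤ (M * (2 * (M / ν) * (1 + M / ν) / Real.pi) + 1) * ‖θ - η‖ := by
        gcongr
        exact le_add_of_nonneg_right zero_le_one

theorem proposition4p3 (n d : ℕ)
    (a : FibreHom.RR d → (FibreHom.CMat n d →L[ℂ] FibreHom.CMat n d))
    (ha : FibreHom.IsCoeff a) :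
    (∀ θ ∈ FibreHom.Theta d, ∀ (r : Fin n) (s : Fin d),
        ∃! N : FibreHom.L2Vec n d × FibreHom.L2Mat n d, FibreHom.IsCellSolution a θ r s N) ∧
      ∃ κ : ℝ, 0 < κ ∧ ∀ θ ∈ FibreHom.Theta d,
        ‖FibreHom.ahom a θ - FibreHom.ahom a 0‖ ≤ κ * ‖θ‖ := by
  obtain ⟨ν, hν, hcoer⟩ := ha.coercive
  obtain ⟨hsol, κ, hκ, hlip⟩ :=
    proposition4p3_general (ha.memLp_top.restrict _) hν (ae_restrict_of_ae hcoer)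
  refine ⟨fun θ hθ => hsol θ fun j => FibreHom.abs_le_pi_of_mem_Theta hθ j, κ, hκ, fun θ hθ => ?_⟩
  simpa only [sub_zero] using hlip θ 0 (FibreHom.abs_le_pi_of_mem_Theta hθ)
    fun j => by simp [Real.pi_nonneg]
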